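/- Let $X_1, X_2, \ldots$ be independent random variables on a common probability space, each with the Exponential distribution of rate $1$. For $n\ge 1$ define \[ Y_n=\begin{cases}\displaystyle\prod_{\substack{1\le i\le n\\ i\text{ odd}}}X_i\Big/\prod_{\substack{1\le i\le n\\ i\text{ even}}}X_i & n\text{ odd},\\[2ex] \displaystyle\prod_{\substack{1\le i\le n\\ i\text{ even}}}X_i\Big/\prod_{\substack{1\le i\le n\\ i\text{ odd}}}X_i & n\text{ even},\end{cases} \qquad Z_n=\begin{cases}\displaystyle\sum_{\substack{1\le i\le n\\ i\text{ odd}}}\ln X_i-\sum_{\substack{1\le i\le n\\ i\text{ even}}}\ln X_i & n\text{ odd},\\[2ex] \displaystyle\sum_{\substack{1\le i\le n\\ i\text{ even}}}\ln X_i-\sum_{\substack{1\le i\le n\\ i\text{ odd}}}\ln X_i & n\text{ even}.\end{cases} \] Then $\ln Y_n=Z_n$ almost surely for every $n\ge1$. Moreover, let $\nu_n=\mathrm{Normal}\big(-\gamma/(\pi\sqrt{n/6}),\,1\big)$ for odd $n$ and $\nu_n=\mathrm{Normal}(0,1)$ for even $n$ (mean and variance), where $\gamma$ is the Euler--Mascheroni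 constant. As $n\to\infty$, \[ \frac{\ln Y_n}{\pi\sqrt{n/6}}=\frac{Z_n}{\pi\sqrt{n/6}}\ \text{ converges in distribution to }\ \nu_n , \] in the sense that $\mathrm E\big[f\big(Z_n/(\pi\sqrt{n/6})\big)\big]-\int f\,d\nu_n\to0$ for every bounded continuous $f:\mathbb R\to\mathbb R$, and likewise with $\ln Y_n$ in place of $Z_n$. In standardized form, for both $\ln Y_n$ and $Z_n$: along odd $n$, $\dfrac{Z_n}{\pi\sqrt{n/6}}+\dfrac{\gamma}{\pi\sqrt{n/6}}$ converges in distribution to $\mathrm{Normal}(0,1)$; along even $n$, $\dfrac{Z_n}{\pi\sqrt{n/6}}$ converges in distribution to $\mathrm{Normal}(0,1)$. -/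

import Mathlib

open MeasureTheory ProbabilityTheory Filter Topology
open scoped BoundedContinuousFunction

noncomputable section

/-- The odd indices `1, 3, …` that are at most `n`. -/
def oddIdx (n : ℕ) : Finset ℕ := (Finset.Icc 1 n).filter Odd

/-- The even indices `2, 4, …` that are at most `n`. -/
def evenIdx (n : ℕ) : Finset ℕ := (Finset.Icc 1 n).filter Even

/-- `Y_n`: the alternating product quotient of `X_1, …, X_n`, where the factors whose index has
the parity of `n` stand in the numerator. -/
def ratioY {Ω : Type*} (X : ℕ → Ω → ℝ) (n : ℕ) (ω : Ω) : ℝ :=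
  if Odd n then (∏ i ∈ oddIdx n, X i ω) / ∏ i ∈ evenIdx n, X i ω
  else (∏ i ∈ evenIdx n, X i ω) / ∏ i ∈ oddIdx n, X i ω

/-- `Z_n`: the alternating sum of `ln X_1, …, ln X_n`, where the terms whose index has
the parity of `n` carry the sign `+`. -/
def logSumZ {Ω : Type*} (X : ℕ → Ω → ℝ) (n : ℕ) (ω : Ω) : ℝ :=
  if Odd n then ∑ i ∈ oddIdx n, Real.log (X i ω) - ∑ i ∈ evenIdx n, Real.log (X i ω)
  else ∑ i ∈ evenIdx n, Real.log (X i ω) - ∑ i ∈ oddIdx n, Real.log (X i ω)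

/-- The normalizing factor `π √(n / 6)`. -/
def scale (n : ℕ) : ℝ := Real.pi * √((n : ℝ) / 6)

/-- The approximating law: `Normal(-γ / (π √(n / 6)), 1)` for odd `n`, and
`Normal(0, 1)` for even `n`. -/
def approxNormal (n : ℕ) : Measure ℝ :=
  if Odd n then gaussianReal (-(Real.eulerMascheroniConstant / scale n)) 1 else gaussianReal 0 1

/-- Convergence in distribution of `W n` (random variables under `P`) to targets `ν n` that may
vary with `n`: the difference between the expectations of every bounded continuous function
tends to `0`. For a constant probability measure `ν n = ν` this is weak convergence to `ν`. -/
def TendstoInLawAlong {Ω : Type*} [MeasurableSpace Ω] (W : ℕ → Ω → ℝ) (P : Measure Ω)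
    (ν : ℕ → Measure ℝ) (l : Filter ℕ) : Prop :=
  (∀ n, AEMeasurable (W n) P) ∧
    ∀ f : ℝ →ᵇ ℝ, Tendsto (fun n => ∫ ω, f (W n ω) ∂P - ∫ x, f x ∂(ν n)) l (𝓝 0)

end

/-! ### The logarithm of an exponential variable -/

section Exponential

/-! The method is characteristic functions. Since `E[X^(it)] = Γ(1 + it)`, independence and the
alternating signs pair the factors of the characteristic function of `Z_n` into `(Γ(1 + it) Γ(1 -
it))^⌊n/2⌋`, with one `Γ(1 + it)` left over for odd `n`. By reflection, `Γ(1 + iu) Γ(1 - iu) = πu /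
sinh(πu)`. At `u = t / scale n` the argument `x = πu` satisfies `x² = 6t²/n`, so `sinh x / x = 1 +
t²/n + o(1/n)` and the power tends to `exp(-t²/2)`; the leftover factor tends to `Γ(1) = 1`. Lévy's
continuity theorem gives the limit `Normal(0, 1)` along all `n`.

The centering `γ / scale n` tends to `0`, so it changes no limit, and the statements by parity are
restrictions of the filter. -/

lemma ae_expMeasure_ne_zero (r : ℝ) : ∀ᵐ x ∂(expMeasure r), x ≠ 0 :=
  (withDensity_absolutelyContinuous volume (gammaPDF 1 r)).ae_le (Measure.ae_ne volume 0)

/-- The characteristic function of `log x` under the exponential law of rate `1` is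
`Γ (1 + i t)`. -/
lemma charFun_map_log_expMeasure (t : ℝ) :
    charFun ((expMeasure 1).map Real.log) t = Complex.Gamma (1 + t * Complex.I) := by
  have hpdf : Measurable (gammaPDF 1 1) := (measurable_gammaPDFReal 1 1).ennreal_ofReal
  rw [charFun_apply_real, integral_map Real.measurable_log.aemeasurable (by fun_prop),
    expMeasure, gammaMeasure, integral_withDensity_eq_integral_toReal_smul hpdf (by simp [gammaPDF]),
    Complex.Gamma_eq_integral (by simp), Complex.GammaIntegral,
    ← integral_indicator measurableSet_Ioi]
  refine integral_congr_ae ?_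
  filter_upwards [Measure.ae_ne volume (0 : ℝ)] with x hx
  -- The density vanishes for `x < 0`; for `x > 0`, `exp(it log x) = x^((1 + it) - 1)` is the power
  -- in Euler's integral.
  rcases lt_or_gt_of_ne hx with hneg | hpos
  · rw [gammaPDF_of_neg hneg, Set.indicator_of_notMem (by simpa using hneg.le)]
    simp
  · rw [gammaPDF_of_nonneg hpos.le, Set.indicator_of_mem (by simpa using hpos),
      ENNReal.toReal_ofReal (by simp; positivity), Complex.real_smul,
      Complex.cpow_def_of_ne_zero (by exact_mod_cast hx), ← Complex.ofReal_log hpos.le]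
    simp only [Real.Gamma_one, sub_self, Real.rpow_zero, Real.rpow_one, one_mul, div_one, mul_one]
    congr 2
    ring

end Exponential

/-! ### Reflection formula -/

section Gamma

/-- Euler's reflection formula on the line `Re s = 1`, with the denominator cleared. -/
lemma Gamma_one_add_mul_I_mul_sinh (u : ℝ) :
    Complex.Gamma (1 + u * Complex.I) * Complex.Gamma (1 - u * Complex.I) *
      Real.sinh (Real.pi * u) = Real.pi * u := by
  rcases eq_or_ne u 0 with rfl | hu
  · simp
  have huI : (u : ℂ) * Complex.I ≠ 0 := by simp [hu]
  have hsinh : (Real.sinh (Real.pi * u) : ℂ) ≠ 0 := by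
    rw [Complex.ofReal_ne_zero, Ne, Real.sinh_eq_zero]
    exact mul_ne_zero Real.pi_ne_zero hu
  -- `Γ(1 + iu) = iu Γ(iu)` brings the product to reflection form, and `sin(iπu) = i sinh(πu)`.
  rw [add_comm, Complex.Gamma_add_one _ huI, mul_assoc (_ * Complex.I) (Complex.Gamma _),
    Complex.Gamma_mul_Gamma_one_sub, ← mul_assoc, Complex.sin_mul_I]
  push_cast at hsinh ⊢
  rw [mul_comm (Real.pi : ℂ) u] at hsinh ⊢
  field_simp

end Gamma

/-! ### Second-order behaviour of `sinh x / x` -/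

section Sinh

/-- Half the difference of the cubic Taylor bounds for `exp` at `x` and `-x`; `5/96 = 5/(4! * 4)` is
the constant of `Real.exp_bound`. -/
lemma abs_sinh_sub_le {x : ℝ} (hx : |x| ≤ 1) :
    |Real.sinh x - (x + x ^ 3 / 6)| ≤ |x| ^ 4 * (5 / 96) := by
  have h1 := Real.exp_bound hx (n := 4) (by norm_num)
  have h2 := Real.exp_bound (x := -x) (by simpa using hx) (n := 4) (by norm_num)
  simp only [Finset.sum_range_succ, Finset.sum_range_zero, Nat.factorial, abs_neg] at h1 h2
  rw [Real.sinh_eq, abs_le]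
  rw [abs_le] at h1 h2
  norm_num at h1 h2
  constructor <;> linarith [h1.1, h1.2, h2.1, h2.2]

lemma tendsto_sinh_div_sub_div_sq :
    Tendsto (fun x : ℝ => (Real.sinh x / x - 1) / x ^ 2) (𝓝[≠] 0) (𝓝 (1 / 6)) := by
  rw [tendsto_iff_norm_sub_tendsto_zero]
  have hlim : Tendsto (fun x : ℝ => |x| * (5 / 96)) (𝓝[≠] 0) (𝓝 0) := by
    have : Tendsto (fun x : ℝ => |x| * (5 / 96)) (𝓝 0) (𝓝 (|0| * (5 / 96))) :=
      (by fun_prop : Continuous fun x : ℝ => |x| * (5 / 96)).tendsto 0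
    simpa using this.mono_left nhdsWithin_le_nhds
  refine squeeze_zero' (.of_forall fun _ => norm_nonneg _) ?_ hlim
  filter_upwards [self_mem_nhdsWithin,
    nhdsWithin_le_nhds (Metric.closedBall_mem_nhds (0 : ℝ) one_pos)] with x hx hx1
  have hx0 : x ≠ 0 := hx
  have hb := abs_sinh_sub_le (x := x) (by simpa using hx1)
  have hpos : 0 < |x| := abs_pos.2 hx0
  have heq : (Real.sinh x / x - 1) / x ^ 2 - 1 / 6 = (Real.sinh x - (x + x ^ 3 / 6)) / x ^ 3 := by
    field_simp
    ring
  rw [heq, Real.norm_eq_abs, abs_div, abs_pow, div_le_iff₀ (by positivity)]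
  calc _ ≤ _ := hb
    _ = _ := by ring

/-- If `x n ^ 2 = 6 t ^ 2 / n`, then `(sinh (x n) / x n) ^ (n / 2)` tends to `exp (t ^ 2 / 2)`. -/
lemma tendsto_sinh_div_pow_half {t : ℝ} (ht : t ≠ 0) :
    Tendsto (fun n : ℕ => (Real.sinh (t / √((n : ℝ) / 6)) / (t / √((n : ℝ) / 6))) ^ (n / 2)) atTop
      (𝓝 (Real.exp (t ^ 2 / 2))) := by
  set x : ℕ → ℝ := fun n => t / √((n : ℝ) / 6) with hx
  set g : ℕ → ℝ := fun n => Real.sinh (x n) / x n - 1 with hg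
  have hx0 : ∀ᶠ n in atTop, x n ≠ 0 := by
    filter_upwards [eventually_gt_atTop 0] with n hn
    have : (0 : ℝ) < n := by exact_mod_cast hn
    exact div_ne_zero ht (by positivity)
  have hxlim : Tendsto x atTop (𝓝[≠] 0) := by
    refine tendsto_nhdsWithin_iff.2 ⟨?_, hx0⟩
    exact tendsto_const_nhds.div_atTop (Real.tendsto_sqrt_atTop.comp
      (tendsto_natCast_atTop_atTop.atTop_div_const (by norm_num)))
  have hng : Tendsto (fun n : ℕ => n * g n) atTop (𝓝 (t ^ 2)) := by
    have h := (tendsto_sinh_div_sub_div_sq.comp hxlim).const_mul (6 * t ^ 2)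
    rw [show 6 * t ^ 2 * (1 / 6) = t ^ 2 by ring] at h
    refine h.congr' ?_
    filter_upwards [eventually_gt_atTop 0] with n hn
    have : (0 : ℝ) < n := by exact_mod_cast hn
    have hsq : x n ^ 2 = 6 * t ^ 2 / n := by
      rw [hx]
      simp only [div_pow]
      rw [Real.sq_sqrt (by positivity)]
      field_simp
    simp only [Function.comp_apply, hsq, hg]
    field_simp
  have hglim : Tendsto g atTop (𝓝 0) := by
    have h := hng.div_atTop (tendsto_natCast_atTop_atTop (R := ℝ))
    refine h.congr' ?_
    filter_upwards [eventually_gt_atTop 0] with n hn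
    have : (0 : ℝ) < n := by exact_mod_cast hn
    field_simp
  -- As `n / 2` is a floor, the parity factor is divided out of the `n`-th power before taking the
  -- square root.
  have hr : Tendsto (fun n => (1 + g n) ^ (n % 2)) atTop (𝓝 1) := by
    rw [tendsto_iff_norm_sub_tendsto_zero]
    refine squeeze_zero (fun _ => norm_nonneg _) (fun n => ?_) (by simpa using hglim.norm)
    rcases Nat.mod_two_eq_zero_or_one n with h | h <;> simp [h]
  have hfull := ((Real.tendsto_one_add_pow_exp_of_tendsto hng).div hr one_ne_zero).sqrt
  have hpos : ∀ᶠ n in atTop, 0 < 1 + g n := by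
    filter_upwards [hglim.eventually (lt_mem_nhds (show (-1 : ℝ) < 0 by norm_num))] with n hn
    linarith
  rw [div_one, Real.sqrt_eq_rpow, ← Real.exp_mul, mul_one_div] at hfull
  refine hfull.congr' ?_
  filter_upwards [hpos] with n hn
  have h1 : (1 + g n) ^ n = ((1 + g n) ^ (n / 2)) ^ 2 * (1 + g n) ^ (n % 2) := by
    rw [← pow_mul, ← pow_add, Nat.div_add_mod' n 2]
  simp only [Pi.div_apply]
  rw [h1, mul_div_assoc, div_self (by positivity), mul_one, Real.sqrt_sq (by positivity)]
  simp only [hg, hx, add_sub_cancel]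

end Sinh

/-! ### The alternating sum and its characteristic function -/

section AlternatingSum

variable {Ω : Type*}

lemma oddIdx_succ (n : ℕ) :
    oddIdx (n + 1) = if Odd (n + 1) then insert (n + 1) (oddIdx n) else oddIdx n := by
  rw [oddIdx, ← Finset.insert_Icc_right_eq_Icc_add_one (by omega), Finset.filter_insert, oddIdx]

lemma evenIdx_succ (n : ℕ) :
    evenIdx (n + 1) = if Even (n + 1) then insert (n + 1) (evenIdx n) else evenIdx n := by
  rw [evenIdx, ← Finset.insert_Icc_right_eq_Icc_add_one (by omega), Finset.filter_insert, evenIdx]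

/-- Passing to `n + 1` changes the parity, so every earlier sign flips. -/
lemma logSumZ_succ (X : ℕ → Ω → ℝ) (n : ℕ) (ω : Ω) :
    logSumZ X (n + 1) ω = Real.log (X (n + 1) ω) - logSumZ X n ω := by
  have ho : n + 1 ∉ oddIdx n := by simp [oddIdx]
  have he : n + 1 ∉ evenIdx n := by simp [evenIdx]
  by_cases h : Odd n
  · have h1 : ¬ Odd (n + 1) := by grind
    have h2 : Even (n + 1) := by grind
    rw [logSumZ, logSumZ, if_neg h1, if_pos h, oddIdx_succ, if_neg h1, evenIdx_succ, if_pos h2,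
      Finset.sum_insert he]
    ring
  · have h1 : Odd (n + 1) := by grind
    have h2 : ¬ Even (n + 1) := by grind
    rw [logSumZ, logSumZ, if_pos h1, if_neg h, oddIdx_succ, if_pos h1, evenIdx_succ, if_neg h2,
      Finset.sum_insert ho]
    ring

lemma logSumZ_eq_sum (X : ℕ → Ω → ℝ) (n : ℕ) (ω : Ω) :
    logSumZ X n ω = ∑ i ∈ Finset.range n, (-1) ^ (n + 1 + i) * Real.log (X (i + 1) ω) := by
  induction n with
  | zero => simp [logSumZ, oddIdx, evenIdx]
  | succ n ih =>
    rw [logSumZ_succ, ih, Finset.sum_range_succ, sub_eq_neg_add, ← Finset.sum_neg_distrib]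
    congr 1
    · refine Finset.sum_congr rfl fun i _ => ?_
      ring
    · rw [show n + 1 + 1 + n = 2 * (n + 1) by ring, pow_mul]
      simp

lemma log_ratioY_eq_logSumZ {X : ℕ → Ω → ℝ} {ω : Ω} (h : ∀ i, 1 ≤ i → X i ω ≠ 0) (n : ℕ) :
    Real.log (ratioY X n ω) = logSumZ X n ω := by
  have ho : ∀ i ∈ oddIdx n, X i ω ≠ 0 := fun i hi =>
    h i (Finset.mem_Icc.1 (Finset.mem_filter.1 hi).1).1
  have he : ∀ i ∈ evenIdx n, X i ω ≠ 0 := fun i hi =>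
    h i (Finset.mem_Icc.1 (Finset.mem_filter.1 hi).1).1
  rw [ratioY, logSumZ]
  split_ifs <;>
    rw [Real.log_div (Finset.prod_ne_zero_iff.2 ‹_›) (Finset.prod_ne_zero_iff.2 ‹_›),
      Real.log_prod ‹_›, Real.log_prod ‹_›]

/-- The induction varies `t`, because a new factor flips all earlier signs and so replaces `t` by
`-t`. -/
lemma prod_alternating (φ : ℝ → ℂ) (n : ℕ) (t : ℝ) :
    ∏ i ∈ Finset.range n, φ ((-1) ^ (n + 1 + i) * t) =
      φ t ^ (n % 2) * (φ t * φ (-t)) ^ (n / 2) := by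
  induction n generalizing t with
  | zero => simp
  | succ n ih =>
    have hshift : ∏ i ∈ Finset.range n, φ ((-1) ^ (n + 1 + 1 + i) * t) =
        ∏ i ∈ Finset.range n, φ ((-1) ^ (n + 1 + i) * -t) :=
      Finset.prod_congr rfl fun i _ => by congr 1; ring
    rw [Finset.prod_range_succ, hshift, ih, show n + 1 + 1 + n = 2 * (n + 1) by ring, pow_mul]
    rcases Nat.even_or_odd' n with ⟨k, rfl | rfl⟩
    · rw [show (2 * k + 1) % 2 = 1 by omega, show (2 * k + 1) / 2 = k by omega,
        show 2 * k % 2 = 0 by omega, show 2 * k / 2 = k by omega]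
      simp [mul_comm]
    · rw [show (2 * k + 1 + 1) % 2 = 0 by omega, show (2 * k + 1 + 1) / 2 = k + 1 by omega,
        show (2 * k + 1) % 2 = 1 by omega, show (2 * k + 1) / 2 = k by omega]
      simp only [neg_neg, even_two, Even.neg_pow, one_pow, one_mul, pow_one, pow_zero]
      ring

variable [MeasurableSpace Ω] {P : Measure Ω} {X : ℕ → Ω → ℝ}

lemma aemeasurable_logSumZ (hX : ∀ i, 1 ≤ i → AEMeasurable (X i) P) (n : ℕ) :
    AEMeasurable (logSumZ X n) P := by
  rw [funext (logSumZ_eq_sum X n)]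
  exact Finset.aemeasurable_fun_sum _ fun i _ => (hX (i + 1) (by omega)).log.const_mul _

lemma ae_log_ratioY_eq_logSumZ (hlaw : ∀ i : ℕ, 1 ≤ i → HasLaw (X i) (expMeasure 1) P) (n : ℕ) :
    (fun ω => Real.log (ratioY X n ω)) =ᵐ[P] logSumZ X n := by
  have hne : ∀ᵐ ω ∂P, ∀ i, 1 ≤ i → X i ω ≠ 0 :=
    ae_all_iff.2 fun i => eventually_imp_distrib_left.2 fun hi =>
      ae_of_ae_map (hlaw i hi).aemeasurable (by
        rw [(hlaw i hi).map_eq]; exact ae_expMeasure_ne_zero 1)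
  filter_upwards [hne] with ω hω using log_ratioY_eq_logSumZ hω n

/-- The characteristic function of the alternating sum of `log X_i`. -/
lemma charFun_map_logSumZ (hlaw : ∀ i : ℕ, 1 ≤ i → HasLaw (X i) (expMeasure 1) P)
    (hindep : iIndepFun (fun i : ℕ => X (i + 1)) P) (n : ℕ) (t : ℝ) :
    charFun (P.map (logSumZ X n)) t =
      Complex.Gamma (1 + t * Complex.I) ^ (n % 2) *
        (Complex.Gamma (1 + t * Complex.I) * Complex.Gamma (1 - t * Complex.I)) ^ (n / 2) := by
  have hm (i : ℕ) : AEMeasurable (fun ω => Real.log (X (i + 1) ω)) P :=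
    (hlaw (i + 1) (by omega)).aemeasurable.log
  have hcf (i : ℕ) (s : ℝ) : charFun (P.map fun ω => Real.log (X (i + 1) ω)) s =
      Complex.Gamma (1 + s * Complex.I) := by
    rw [← charFun_map_log_expMeasure, ← (hlaw (i + 1) (by omega)).map_eq,
      AEMeasurable.map_map_of_aemeasurable Real.measurable_log.aemeasurable
        (hlaw (i + 1) (by omega)).aemeasurable]
    rfl
  have hind : iIndepFun (fun (i : ℕ) ω => (-1 : ℝ) ^ (n + 1 + i) * Real.log (X (i + 1) ω)) P :=
    hindep.comp (fun i x => (-1 : ℝ) ^ (n + 1 + i) * Real.log x)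
      fun i => Real.measurable_log.const_mul _
  have h := prod_alternating (fun s : ℝ => Complex.Gamma (1 + s * Complex.I)) n t
  simp only [Complex.ofReal_neg, neg_mul, ← sub_eq_add_neg] at h
  rw [funext (logSumZ_eq_sum X n),
    iIndepFun.charFun_map_fun_finsetSum_eq_prod (fun i _ => (hm i).const_mul _) (hind.restrict _),
    Finset.prod_apply, ← h]
  refine Finset.prod_congr rfl fun i _ => ?_
  rw [charFun_map_mul_comp (hm i), hcf]

end AlternatingSum

/-! ### Passage to the limit -/

section Limit

lemma tendsto_div_scale (t : ℝ) : Tendsto (fun n => t / scale n) atTop (𝓝 0) := by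
  refine tendsto_const_nhds.div_atTop (Tendsto.const_mul_atTop Real.pi_pos ?_)
  exact Real.tendsto_sqrt_atTop.comp (tendsto_natCast_atTop_atTop.atTop_div_const (by norm_num))

lemma tendsto_Gamma_reflection_pow (t : ℝ) :
    Tendsto (fun n : ℕ => (Complex.Gamma (1 + (t / scale n : ℝ) * Complex.I) *
      Complex.Gamma (1 - (t / scale n : ℝ) * Complex.I)) ^ (n / 2)) atTop
      (𝓝 (Complex.exp (-(t ^ 2 / 2)))) := by
  -- At `t = 0` the quotient `sinh x / x` would be `0 / 0`.
  rcases eq_or_ne t 0 with rfl | ht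
  · simp
  have h := (tendsto_sinh_div_pow_half ht).inv₀ (Real.exp_pos _).ne'
  rw [← Real.exp_neg] at h
  have hc := (Complex.continuous_ofReal.tendsto _).comp h
  push_cast at hc
  refine hc.congr' ?_
  filter_upwards [eventually_gt_atTop 0] with n hn
  have hn' : (0 : ℝ) < n := by exact_mod_cast hn
  have hx : t / √((n : ℝ) / 6) ≠ 0 := div_ne_zero ht (by positivity)
  have hpi : Real.pi * (t / scale n) = t / √((n : ℝ) / 6) := by
    rw [scale]
    field_simp
  have hsinh : (Real.sinh (t / √((n : ℝ) / 6)) : ℂ) ≠ 0 := by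
    rwa [Complex.ofReal_ne_zero, Ne, Real.sinh_eq_zero]
  have hr := Gamma_one_add_mul_I_mul_sinh (t / scale n)
  rw [← Complex.ofReal_mul, hpi] at hr
  rw [eq_div_of_mul_eq hsinh hr, Function.comp_apply, ← inv_pow, inv_div]
  norm_cast

lemma tendsto_Gamma_pow_mod_two (t : ℝ) :
    Tendsto (fun n : ℕ => Complex.Gamma (1 + (t / scale n : ℝ) * Complex.I) ^ (n % 2)) atTop
      (𝓝 1) := by
  have hG : Tendsto (fun n : ℕ => Complex.Gamma (1 + (t / scale n : ℝ) * Complex.I)) atTop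
      (𝓝 1) := by
    have h1 : Tendsto (fun n : ℕ => 1 + ((t / scale n : ℝ) : ℂ) * Complex.I) atTop (𝓝 1) := by
      have h : Continuous fun u : ℝ => 1 + (u : ℂ) * Complex.I := by fun_prop
      simpa [Function.comp_def] using (h.tendsto 0).comp (tendsto_div_scale t)
    simpa [Function.comp_def] using Complex.continuousAt_Gamma_one.tendsto.comp h1
  rw [tendsto_iff_norm_sub_tendsto_zero] at hG ⊢
  refine squeeze_zero (fun _ => norm_nonneg _) (fun n => ?_) hG
  rcases Nat.mod_two_eq_zero_or_one n with h | h <;> simp [h]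

variable {Ω : Type*} [MeasurableSpace Ω] {P : Measure Ω} [IsProbabilityMeasure P]
  {X : ℕ → Ω → ℝ}

/-- The normalized alternating sum, shifted by a null sequence, is asymptotically standard
normal. -/
lemma tendstoInDistribution_logSumZ_div_scale_sub
    (hlaw : ∀ i : ℕ, 1 ≤ i → HasLaw (X i) (expMeasure 1) P)
    (hindep : iIndepFun (fun i : ℕ => X (i + 1)) P) {c : ℕ → ℝ} (hc : Tendsto c atTop (𝓝 0)) :
    TendstoInDistribution (fun (n : ℕ) ω => logSumZ X n ω / scale n - c n) atTop
      (id : ℝ → ℝ) (fun _ => P) (gaussianReal 0 1) where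
  forall_aemeasurable n :=
    ((aemeasurable_logSumZ (fun i hi => (hlaw i hi).aemeasurable) n).div_const _).sub_const _
  aemeasurable_limit := aemeasurable_id
  tendsto := by
    have hZ := aemeasurable_logSumZ (fun i hi => (hlaw i hi).aemeasurable)
    refine ProbabilityMeasure.tendsto_of_tendsto_charFun fun t => ?_
    have hcf (n : ℕ) : charFun (P.map fun ω => logSumZ X n ω / scale n - c n) t =
        charFun (P.map (logSumZ X n)) (t / scale n) * Complex.exp (-(c n * t) * Complex.I) := by
      have hmap : P.map (fun ω => logSumZ X n ω / scale n - c n) =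
          (P.map fun ω => (scale n)⁻¹ * logSumZ X n ω).map (fun x => x + -c n) := by
        rw [AEMeasurable.map_map_of_aemeasurable (by fun_prop) ((hZ n).const_mul _)]
        congr 1
        ext ω
        simp [div_eq_inv_mul, sub_eq_add_neg]
      rw [hmap, charFun_map_add_const, charFun_map_mul_comp (hZ n), div_eq_inv_mul]
      simp [mul_comm]
    have hexp : Tendsto (fun n => Complex.exp (-(c n * t) * Complex.I)) atTop (𝓝 1) := by
      have h : Continuous fun u : ℝ => Complex.exp (-(u * t) * Complex.I) := by fun_prop
      simpa [Function.comp_def] using (h.tendsto 0).comp hc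
    have hmain := ((tendsto_Gamma_pow_mod_two t).mul (tendsto_Gamma_reflection_pow t)).mul hexp
    simp only [ProbabilityMeasure.coe_mk, Measure.map_id, charFun_gaussianReal, hcf,
      charFun_map_logSumZ hlaw hindep]
    simpa using hmain

lemma TendstoInDistribution.mono_filter {ι E Ω' : Type*} [TopologicalSpace E] [MeasurableSpace E]
    [OpensMeasurableSpace E] {Y : ι → Ω → E} {Z : Ω' → E} {l l' : Filter ι} [MeasurableSpace Ω']
    {Q : Measure Ω'} [IsProbabilityMeasure Q]
    (h : TendstoInDistribution Y l Z (fun _ => P) Q) (hl : l' ≤ l) :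
    TendstoInDistribution Y l' Z (fun _ => P) Q :=
  ⟨h.forall_aemeasurable, h.aemeasurable_limit, h.tendsto.mono_left hl⟩

instance isProbabilityMeasure_approxNormal (n : ℕ) : IsProbabilityMeasure (approxNormal n) := by
  unfold approxNormal
  split_ifs <;> infer_instance

/-- The means tend to `0`, so the moving targets may be exchanged for `Normal(0, 1)`. -/
lemma tendsto_integral_approxNormal (f : ℝ →ᵇ ℝ) :
    Tendsto (fun n => ∫ x, f x ∂(approxNormal n)) atTop (𝓝 (∫ x, f x ∂(gaussianReal 0 1))) := by
  let ν : ℕ → ProbabilityMeasure ℝ := fun n => ⟨approxNormal n, inferInstance⟩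
  let ν₀ : ProbabilityMeasure ℝ := ⟨gaussianReal 0 1, inferInstance⟩
  set m : ℕ → ℝ := fun n => if Odd n then -(Real.eulerMascheroniConstant / scale n) else 0 with hm
  have hν (n : ℕ) : approxNormal n = gaussianReal (m n) 1 := by
    simp only [approxNormal, hm]
    split_ifs <;> rfl
  have hmlim : Tendsto m atTop (𝓝 0) := by
    refine squeeze_zero_norm (fun n => ?_)
      (by simpa using (tendsto_div_scale Real.eulerMascheroniConstant).norm)
    simp only [hm]
    split_ifs
    · simp
    · simpa using by positivity
  have hlim : Tendsto ν atTop (𝓝 ν₀) := by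
    refine ProbabilityMeasure.tendsto_of_tendsto_charFun fun t => ?_
    simp only [ν, ν₀, ProbabilityMeasure.coe_mk, hν, charFun_gaussianReal]
    have h : Continuous fun u : ℝ =>
        Complex.exp (t * u * Complex.I - ((1 : NNReal) : ℝ) * t ^ 2 / 2) := by fun_prop
    exact (h.tendsto 0).comp hmlim
  exact ProbabilityMeasure.tendsto_iff_forall_integral_tendsto.1 hlim f

lemma TendstoInLawAlong.of_tendstoInDistribution {W : ℕ → Ω → ℝ}
    (h : TendstoInDistribution W atTop (id : ℝ → ℝ) (fun _ => P) (gaussianReal 0 1)) :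
    TendstoInLawAlong W P approxNormal atTop := by
  refine ⟨h.forall_aemeasurable, fun f => ?_⟩
  have h1 := ProbabilityMeasure.tendsto_iff_forall_integral_tendsto.1 h.tendsto f
  simp only [ProbabilityMeasure.coe_mk, Measure.map_id] at h1
  have h2 := h1.sub (tendsto_integral_approxNormal f)
  rw [sub_self] at h2
  refine h2.congr fun n => ?_
  rw [integral_map (h.forall_aemeasurable n) f.continuous.aestronglyMeasurable]

end Limit

theorem proposition3 {Ω : Type*} [MeasurableSpace Ω] (P : Measure Ω) [IsProbabilityMeasure P]
    (X : ℕ → Ω → ℝ)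
    (hlaw : ∀ i : ℕ, 1 ≤ i → HasLaw (X i) (expMeasure 1) P)
    (hindep : iIndepFun (fun i : ℕ => X (i + 1)) P) :
    -- `ln Y_n = Z_n` almost surely
    (∀ n : ℕ, 1 ≤ n → (fun ω => Real.log (ratioY X n ω)) =ᵐ[P] logSumZ X n) ∧
    -- asymptotic normality with the `n`-dependent normal laws
    TendstoInLawAlong (fun n ω => Real.log (ratioY X n ω) / scale n) P approxNormal atTop ∧
    TendstoInLawAlong (fun n ω => logSumZ X n ω / scale n) P approxNormal atTop ∧
    -- the same, in standardized form: for odd `n` after subtraction of the mean, for even `n` as is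
    TendstoInDistribution
      (fun (n : ℕ) ω => Real.log (ratioY X n ω) / scale n
        - (-(Real.eulerMascheroniConstant / scale n)))
      (atTop ⊓ 𝓟 {n : ℕ | Odd n}) (id : ℝ → ℝ) (fun _ => P) (gaussianReal 0 1) ∧
    TendstoInDistribution
      (fun (n : ℕ) ω => logSumZ X n ω / scale n - (-(Real.eulerMascheroniConstant / scale n)))
      (atTop ⊓ 𝓟 {n : ℕ | Odd n}) (id : ℝ → ℝ) (fun _ => P) (gaussianReal 0 1) ∧
    TendstoInDistribution
      (fun (n : ℕ) ω => Real.log (ratioY X n ω) / scale n)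
      (atTop ⊓ 𝓟 {n : ℕ | Even n}) (id : ℝ → ℝ) (fun _ => P) (gaussianReal 0 1) ∧
    TendstoInDistribution
      (fun (n : ℕ) ω => logSumZ X n ω / scale n)
      (atTop ⊓ 𝓟 {n : ℕ | Even n}) (id : ℝ → ℝ) (fun _ => P) (gaussianReal 0 1) := by
  have hY := ae_log_ratioY_eq_logSumZ hlaw
  have hmean : Tendsto (fun n => -(Real.eulerMascheroniConstant / scale n)) atTop (𝓝 0) := by
    simpa using (tendsto_div_scale Real.eulerMascheroniConstant).neg
  have hZ : TendstoInDistribution (fun (n : ℕ) ω => logSumZ X n ω / scale n) atTop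
      (id : ℝ → ℝ) (fun _ => P) (gaussianReal 0 1) := by
    simpa using tendstoInDistribution_logSumZ_div_scale_sub hlaw hindep
      (c := fun _ => 0) tendsto_const_nhds
  have hZc := tendstoInDistribution_logSumZ_div_scale_sub hlaw hindep hmean
  have hL : TendstoInDistribution (fun (n : ℕ) ω => Real.log (ratioY X n ω) / scale n) atTop
      (id : ℝ → ℝ) (fun _ => P) (gaussianReal 0 1) :=
    hZ.congr (fun n => by filter_upwards [hY n] with ω hω; rw [hω]) .rfl
  have hLc : TendstoInDistribution (fun (n : ℕ) ω => Real.log (ratioY X n ω) / scale n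
        - (-(Real.eulerMascheroniConstant / scale n))) atTop
      (id : ℝ → ℝ) (fun _ => P) (gaussianReal 0 1) :=
    hZc.congr (fun n => by filter_upwards [hY n] with ω hω; rw [hω]) .rfl
  exact ⟨fun n _ => hY n, .of_tendstoInDistribution hL, .of_tendstoInDistribution hZ,
    TendstoInDistribution.mono_filter hLc inf_le_left,
    TendstoInDistribution.mono_filter hZc inf_le_left,
    TendstoInDistribution.mono_filter hL inf_le_left,
    TendstoInDistribution.mono_filter hZ inf_le_left⟩
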